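/- **Setting.** Consider an episodic decision problem with measurable state space $\mathbb S$, measurable action space $\mathbb A$, horizon $H\ge 1$, initial distribution $\mu_0$ and transition kernels $P_h(\cdot\mid s,a)$. Every trajectory $\tau=((s_1,a_1),\dots,(s_H,a_H))$ has a (measurable) reward $r(\tau)\in[0,H]$. For $\theta\in\mathbb R^d$, $d\ge1$, let $\pi_\theta$ be a policy, i.e. for each step a distribution over actions given the state, depending measurably on $(\theta,s)$. Write $V(\pi_\theta)=\mathbb E_{s\sim\mu_0}\,\mathbb E_{\pi_\theta}[r(\tau)\mid s_1=s]$. A human who compares $(\tau_0,\tau_1)$ answers $o=1$ with probability $\sigma(r(\tau_1)-r(\tau_0))$ and $o=0$ otherwise, where $\sigma:\mathbb R\to[0,1]$ is the link function. **Assumptions.** (i) $\sigma$ is measurable and strictly increasing on $[-H,H]$, with $\sigma(0)=\tfrac12$. (ii) With $\Delta=\min\{\sigma(-H),1-\sigma(H)\}$, the inverse link $\sigma^{-1}$ is $L$-Lipschitz on $[\Delta,1-\Delta]$. (iii) $\theta\mapsto V(\pi_\theta)$ is $L$-smooth on $\mathbb R^d$, i.e. differentiable with $L$-Lipschitz gradient.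 **Algorithm (ZPG).** Given $\theta_0$, step size $\alpha$, perturbation distance $\mu>0$ and integers $N,M$, in each iteration $t=0,\dots,T-1$: draw $v_t$ uniformly from the unit sphere of $\mathbb R^d$; for $n=1,\dots,N$ draw independent trajectories $\tau_{n,0}\sim\pi_{\theta_t}$ and $\tau_{n,1}\sim\pi_{\theta_t+\mu v_t}$, obtain $M$ independent human answers $o_{n,1},\dots,o_{n,M}$ on $(\tau_{n,0},\tau_{n,1})$, and put $p_{t,n}=\min\{\max\{\tfrac1M\sum_m o_{n,m},\Delta\},1-\Delta\}$; then set $\hat g_t=\frac d\mu\cdot\frac{\sum_{n}\sigma^{-1}(p_{t,n})}{N}\,v_t$ and $\theta_{t+1}=\theta_t+\alpha\hat g_t$. **Theorem.** There is a universal constant $K>0$ with the following property. Let $a_1,m_1,m_2>0$, $N,T\ge1$, $M\ge2$, and suppose that $$\frac{a_1}{d}\le\alpha\le\frac{1}{12Ld},\qquad m_1\max\Big\{\frac1{\sqrt M},\frac H{\sqrt{dN}}\Big\}\le\mu^2\le m_2\max\Big\{\frac1{\sqrt M},\frac H{\sqrt{dN}}\Big\}.$$ If $R$ is uniform on $\{0,\dots,T-1\}$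 and independent of the run, then $\|\nabla_\theta V(\pi_{\theta_R})\|_2^2$ is integrable and $$\mathbb E\big[\|\nabla_\theta V(\pi_{\theta_R})\|_2^2\big]\le K\Big(\frac1{a_1}+L^2\Big(m_2+\frac1{m_1}\Big)\Big)\left(\frac{Hd}{T}+\frac{d^2\sqrt{\log M}}{\sqrt M}+\frac{Hd\sqrt d}{\sqrt N}\right).$$ In particular, for $\mu^2=\Theta(\max\{1/\sqrt M,H/\sqrt{dN}\})$ and $\alpha=\Theta(1/d)$ (with $\alpha\le 1/(12Ld)$), the left side is $O\big(Hd/T+d^2\sqrt{\log M}/\sqrt M+Hd\sqrt d/\sqrt N\big)$, with an implied constant that depends only on $L$ and on the constants in the two $\Theta$'s. -/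

import Mathlib

open MeasureTheory ProbabilityTheory
open scoped ENNReal NNReal

namespace ZPG

noncomputable section

/-! ### Independent copies drawn from a Markov kernel -/

/-- If `κ` is a Markov kernel then `a ↦ (κ a)^{⊗ n}` is measurable. -/
lemma measurable_pi_kernel {α β : Type*} [MeasurableSpace α] [MeasurableSpace β]
    (κ : Kernel α β) [IsMarkovKernel κ] (n : ℕ) :
    Measurable (fun a => Measure.pi (fun _ : Fin n => κ a)) := by
  refine Measurable.measure_of_isPiSystem_of_isProbabilityMeasure
    (generateFrom_pi (α := fun _ : Fin n => β)).symm isPiSystem_pi ?_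
  rintro _ ⟨s, hs, rfl⟩
  simp only [Measure.pi_pi]
  refine Finset.measurable_prod _ fun i _ => ?_
  exact Kernel.measurable_coe κ (hs i (Set.mem_univ i))

/-- `n` independent draws from `κ a`. -/
def iid {α β : Type*} [MeasurableSpace α] [MeasurableSpace β]
    (κ : Kernel α β) [IsMarkovKernel κ] (n : ℕ) : Kernel α (Fin n → β) where
  toFun a := Measure.pi (fun _ : Fin n => κ a)
  measurable' := measurable_pi_kernel κ n

instance {α β : Type*} [MeasurableSpace α] [MeasurableSpace β]
    (κ : Kernel α β) [IsMarkovKernel κ] (n : ℕ) : IsMarkovKernel (iid κ n) :=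
  ⟨fun a => inferInstanceAs (IsProbabilityMeasure (Measure.pi (fun _ : Fin n => κ a)))⟩

lemma measurable_snoc {β : Type*} [MeasurableSpace β] (k : ℕ) :
    Measurable (fun x : (Fin k → β) × β => (Fin.snoc x.1 x.2 : Fin (k + 1) → β)) := by
  refine measurable_pi_lambda _ fun i => ?_
  refine Fin.lastCases ?_ (fun j => ?_) i
  · simpa using measurable_snd
  · simpa [Function.comp_def] using (measurable_pi_apply j).comp measurable_fst

/-! ### Episodic reinforcement learning -/

/-- The parameter space `ℝ^d` with the Euclidean norm. -/
abbrev Param (d : ℕ) : Type := EuclideanSpace ℝ (Fin d)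

/-- A trajectory `((s_1, a_1), …, (s_H, a_H))`. -/
abbrev Traj (S A : Type*) (H : ℕ) : Type _ := Fin H → S × A

/-- An episodic decision problem with horizon `H`: initial distribution, transition kernels
(`trans k` is used to go from the state-action pair number `k + 1` to the state number `k + 2`,
counting from `1`), and a trajectory reward with values in `[0, H]`. -/
structure EpisodicMDP (S A : Type*) [MeasurableSpace S] [MeasurableSpace A] (H : ℕ) where
  init : Measure S
  init_prob : IsProbabilityMeasure init
  trans : ℕ → Kernel (S × A) S
  trans_markov : ∀ k, IsMarkovKernel (trans k)
  reward : Traj S A H → ℝ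
  measurable_reward : Measurable reward
  reward_mem : ∀ τ, reward τ ∈ Set.Icc (0 : ℝ) H

/-- A parameterized policy: for every parameter `θ`, step `k` (counted from `0`) and state `s`,
a distribution over actions, jointly measurable in `(θ, s)`. -/
structure PolicyNetwork (d : ℕ) (S A : Type*) [MeasurableSpace S] [MeasurableSpace A] where
  kernel : ℕ → Kernel (Param d × S) A
  markov : ∀ k, IsMarkovKernel (kernel k)

attribute [instance] EpisodicMDP.init_prob EpisodicMDP.trans_markov PolicyNetwork.markov

section Rollout

variable {d H : ℕ} {S A : Type*} [MeasurableSpace S] [MeasurableSpace A]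

/-- Distribution of the next state, given the initial state and the first `k` state-action pairs. -/
def nextState (𝓜 : EpisodicMDP S A H) : (k : ℕ) → Kernel (S × (Fin k → S × A)) S
  | 0 => Kernel.deterministic Prod.fst measurable_fst
  | k + 1 => (𝓜.trans k).comap (fun x => x.2 (Fin.last k)) (by fun_prop)

instance (𝓜 : EpisodicMDP S A H) (k : ℕ) : IsMarkovKernel (nextState 𝓜 k) := by
  cases k <;> (unfold nextState; infer_instance)

/-- Distribution of the next state-action pair, given the parameter, the initial state and the
first `k` state-action pairs. -/
def nextPair (𝓜 : EpisodicMDP S A H) (π : PolicyNetwork d S A) (k : ℕ) :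
    Kernel ((Param d × S) × (Fin k → S × A)) (S × A) :=
  ((nextState 𝓜 k).comap (fun x => (x.1.2, x.2)) (by fun_prop)) ⊗ₖ
    ((π.kernel k).comap (fun x => (x.1.1.1, x.2)) (by fun_prop))

instance (𝓜 : EpisodicMDP S A H) (π : PolicyNetwork d S A) (k : ℕ) :
    IsMarkovKernel (nextPair 𝓜 π k) := by
  unfold nextPair; infer_instance

/-- Distribution of the first `k` state-action pairs, given `(θ, s)`, when the policy `π_θ` is
run from the initial state `s`. -/
def rolloutFrom (𝓜 : EpisodicMDP S A H) (π : PolicyNetwork d S A) :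
    (k : ℕ) → Kernel (Param d × S) (Fin k → S × A)
  | 0 => Kernel.const _ (Measure.dirac Fin.elim0)
  | k + 1 => (rolloutFrom 𝓜 π k ⊗ₖ nextPair 𝓜 π k).map (fun x => Fin.snoc x.1 x.2)

instance (𝓜 : EpisodicMDP S A H) (π : PolicyNetwork d S A) (k : ℕ) :
    IsMarkovKernel (rolloutFrom 𝓜 π k) := by
  induction k with
  | zero => unfold rolloutFrom; infer_instance
  | succ k ih => unfold rolloutFrom; exact Kernel.IsMarkovKernel.map _ (measurable_snoc k)

/-- The trajectory distribution of `π_θ`: `s_1 ∼ μ₀`, then `π_θ` is run for `H` steps. -/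
def trajKernel (𝓜 : EpisodicMDP S A H) (π : PolicyNetwork d S A) :
    Kernel (Param d) (Traj S A H) :=
  (Kernel.const (Param d) 𝓜.init ⊗ₖ rolloutFrom 𝓜 π H).snd

instance (𝓜 : EpisodicMDP S A H) (π : PolicyNetwork d S A) :
    IsMarkovKernel (trajKernel 𝓜 π) := by
  unfold trajKernel; infer_instance

/-- `V₁^{π_θ}(s)`, the expected trajectory reward from the initial state `s`. -/
def initialValue (𝓜 : EpisodicMDP S A H) (π : PolicyNetwork d S A) (θ : Param d) (s : S) : ℝ :=
  ∫ τ, 𝓜.reward τ ∂(rolloutFrom 𝓜 π H (θ, s))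

/-- `V(π_θ) = E_{s ∼ μ₀} V₁^{π_θ}(s)`. -/
def value (𝓜 : EpisodicMDP S A H) (π : PolicyNetwork d S A) (θ : Param d) : ℝ :=
  ∫ s, initialValue 𝓜 π θ s ∂𝓜.init

end Rollout

/-- `L`-smoothness: differentiable with `L`-Lipschitz gradient. -/
def LSmooth {d : ℕ} (L : ℝ≥0) (f : Param d → ℝ) : Prop :=
  Differentiable ℝ f ∧ LipschitzWith L (gradient f)

/-! ### Preference model -/

/-- The trim constant `Δ = min {σ(-H), 1 - σ(H)}`. -/
def trimLevel (σ : ℝ → unitInterval) (H : ℕ) : ℝ := min (σ (-H) : ℝ) (1 - (σ H : ℝ))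

/-- `trim[a | Δ]`. -/
def trim (a Δ : ℝ) : ℝ := min (max a Δ) (1 - Δ)

/-- The conditions on the link function: `σ : ℝ → [0, 1]` is strictly increasing on `[-H, H]`,
and `σ(0) = 1/2`. -/
structure IsLink (σ : ℝ → unitInterval) (H : ℕ) : Prop where
  measurable : Measurable σ
  strictMono : StrictMonoOn σ (Set.Icc (-(H : ℝ)) H)
  zero : (σ 0 : ℝ) = 1 / 2

/-- `σinv` is the inverse link function, and it is `L`-Lipschitz on `[Δ, 1 - Δ]`. The values of
`σ` on `[-H, H]` all lie in `[Δ, 1 - Δ]`. -/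
structure IsLipschitzInverseLink (σ : ℝ → unitInterval) (σinv : ℝ → ℝ) (H : ℕ) (L : ℝ≥0) :
    Prop where
  left_inv : ∀ x ∈ Set.Icc (-(H : ℝ)) H, σinv (σ x) = x
  lipschitz : LipschitzOnWith L σinv (Set.Icc (trimLevel σ H) (1 - trimLevel σ H))

lemma measurable_bernoulli :
    Measurable (fun p : unitInterval => bernoulliMeasure true false p) := by
  refine Measure.measurable_of_measurable_coe _ fun s hs => ?_
  simp only [bernoulliMeasure_def, Measure.coe_add, Measure.coe_nnreal_smul_apply, Pi.add_apply]
  fun_prop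

section Algorithm

variable {d H : ℕ} {S A : Type*} [MeasurableSpace S] [MeasurableSpace A]

/-- One human evaluator compares `(τ₀, τ₁)`: the answer is `true` (`o = 1`, `τ₁` preferred) with
probability `σ(r(τ₁) - r(τ₀))`. -/
def feedback (𝓜 : EpisodicMDP S A H) {σ : ℝ → unitInterval} (hσ : Measurable σ) :
    Kernel (Traj S A H × Traj S A H) Bool where
  toFun x := bernoulliMeasure true false (σ (𝓜.reward x.2 - 𝓜.reward x.1))
  measurable' := measurable_bernoulli.comp (hσ.comp
    ((𝓜.measurable_reward.comp measurable_snd).sub (𝓜.measurable_reward.comp measurable_fst)))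

instance (𝓜 : EpisodicMDP S A H) {σ : ℝ → unitInterval} (hσ : Measurable σ) :
    IsMarkovKernel (feedback 𝓜 hσ) :=
  ⟨fun x => inferInstanceAs (IsProbabilityMeasure
    (bernoulliMeasure true false (σ (𝓜.reward x.2 - 𝓜.reward x.1))))⟩

/-- The uniform distribution on the unit sphere of `ℝ^d`: normalized surface measure. -/
def sphereUniform (d : ℕ) : Measure (Param d) :=
  (cond (volume : Measure (Param d)).toSphere Set.univ).map Subtype.val

instance (d : ℕ) [NeZero d] : IsProbabilityMeasure (sphereUniform d) := by
  have : (volume : Measure (Param d)).toSphere Set.univ ≠ 0 := by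
    rw [Measure.measure_univ_ne_zero]
    exact Measure.toSphere_ne_zero _
  have := cond_isProbabilityMeasure this
  exact Measure.isProbabilityMeasure_map measurable_subtype_coe.aemeasurable

/-- One inner iteration, given `(θ, θ')`: independent trajectories `τ₀ ∼ π_θ` and `τ₁ ∼ π_θ'`,
then `M` independent evaluations of `(τ₀, τ₁)`. -/
def pairQuery (𝓜 : EpisodicMDP S A H) (π : PolicyNetwork d S A)
    {σ : ℝ → unitInterval} (hσ : Measurable σ) (M : ℕ) :
    Kernel (Param d × Param d) ((Traj S A H × Traj S A H) × (Fin M → Bool)) :=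
  (((trajKernel 𝓜 π).comap Prod.fst measurable_fst) ×ₖ
      ((trajKernel 𝓜 π).comap Prod.snd measurable_snd)) ⊗ₖ
    ((iid (feedback 𝓜 hσ) M).comap Prod.snd measurable_snd)

instance (𝓜 : EpisodicMDP S A H) (π : PolicyNetwork d S A)
    {σ : ℝ → unitInterval} (hσ : Measurable σ) (M : ℕ) :
    IsMarkovKernel (pairQuery 𝓜 π hσ M) := by
  unfold pairQuery; infer_instance

/-- `trim[(∑_m o_m) / M | Δ]`. -/
def preferenceEstimate (Δ : ℝ) {M : ℕ} (o : Fin M → Bool) : ℝ :=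
  trim (∑ m, (if o m then (1 : ℝ) else 0) / M) Δ

/-- The gradient estimate `ĝ = (d / μ) ((∑_n σ⁻¹(p_n)) / N) v`. -/
def gradEstimate (σinv : ℝ → ℝ) (Δ μ : ℝ) {N M : ℕ} (v : Param d)
    (o : Fin N → Fin M → Bool) : Param d :=
  ((d : ℝ) / μ * ((∑ n, σinv (preferenceEstimate Δ (o n))) / N)) • v

/-- One iteration of the algorithm, as a Markov kernel from `θ_t` to `θ_{t+1}`: draw `v` uniformly
from the sphere, run `N` independent inner iterations with `(θ_t, θ_t + μ v)`, and move to
`θ_t + α ĝ`. -/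
def zpgStep (𝓜 : EpisodicMDP S A H) (π : PolicyNetwork d S A)
    {σ : ℝ → unitInterval} (hσ : Measurable σ) (σinv : ℝ → ℝ) (N M : ℕ) (α μ : ℝ) :
    Kernel (Param d) (Param d) :=
  (Kernel.id ×ₖ (Kernel.const (Param d) (sphereUniform d) ⊗ₖ
      (iid (pairQuery 𝓜 π hσ M) N).comap (fun x => (x.1, x.1 + μ • x.2)) (by fun_prop))).map
    (fun x => x.1 + α • gradEstimate σinv (trimLevel σ H) μ x.2.1 (fun n => (x.2.2 n).2))

lemma measurable_update (σinv : ℝ → ℝ) (Δ α μ : ℝ) (N M : ℕ) :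
    Measurable (fun x : Param d × Param d ×
        (Fin N → (Traj S A H × Traj S A H) × (Fin M → Bool)) =>
      x.1 + α • gradEstimate σinv Δ μ x.2.1 (fun n => (x.2.2 n).2)) := by
  unfold gradEstimate
  have h : Measurable (fun x : Param d × Param d ×
        (Fin N → (Traj S A H × Traj S A H) × (Fin M → Bool)) =>
      ∑ n, σinv (preferenceEstimate Δ (x.2.2 n).2)) := by
    refine Finset.measurable_sum _ fun n _ => ?_
    exact (measurable_of_finite (fun o : Fin M → Bool => σinv (preferenceEstimate Δ o))).comp
      (measurable_snd.comp ((measurable_pi_apply n).comp (measurable_snd.comp measurable_snd)))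
  fun_prop

instance [NeZero d] (𝓜 : EpisodicMDP S A H) (π : PolicyNetwork d S A)
    {σ : ℝ → unitInterval} (hσ : Measurable σ) (σinv : ℝ → ℝ) (N M : ℕ) (α μ : ℝ) :
    IsMarkovKernel (zpgStep 𝓜 π hσ σinv N M α μ) := by
  unfold zpgStep
  exact Kernel.IsMarkovKernel.map _ (measurable_update σinv _ α μ N M)

/-- Law of `(θ_0, …, θ_t)` for the algorithm started at `θ₀`. -/
def zpgPath (𝓜 : EpisodicMDP S A H) (π : PolicyNetwork d S A)
    {σ : ℝ → unitInterval} (hσ : Measurable σ) (σinv : ℝ → ℝ) (N M : ℕ) (α μ : ℝ)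
    (θ₀ : Param d) : (t : ℕ) → Measure (Fin (t + 1) → Param d)
  | 0 => Measure.dirac (fun _ => θ₀)
  | t + 1 => (zpgPath 𝓜 π hσ σinv N M α μ θ₀ t ⊗ₘ
      (zpgStep 𝓜 π hσ σinv N M α μ).comap (fun p => p (Fin.last t)) (by fun_prop)).map
        (fun x => Fin.snoc x.1 x.2)

/-- Law of `θ_R`, where `R` is uniform on `{0, …, T - 1}` and independent of the `T` iterations
of the algorithm. -/
def zpgOutput (𝓜 : EpisodicMDP S A H) (π : PolicyNetwork d S A)
    {σ : ℝ → unitInterval} (hσ : Measurable σ) (σinv : ℝ → ℝ) (N M : ℕ) (α μ : ℝ)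
    (θ₀ : Param d) (T : ℕ) : Measure (Param d) :=
  ((zpgPath 𝓜 π hσ σinv N M α μ θ₀ T).prod (uniformOn (Set.univ : Set (Fin T)))).map
    (fun x => x.1 x.2.castSucc)

end Algorithm

end

end ZPG

/-!
The argument is stochastic gradient ascent with a biased zeroth-order gradient estimate, with the
human feedback entering only through one scalar per iteration.

*The scalar.* The update is `θ + (α d / μ) Y v`, where `v` is a uniform direction and `Y`
(`valueDiffEstimate`) estimates `V(θ + μ v) - V(θ)`. As the inverse link is `L`-Lipschitz,
vanishes at `1 / 2` and is evaluated in `[0, 1]`, each of the `N` independent terms averaged in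
`Y` is at most `L / 2` in absolute value, so the variance of `Y` is at most `L² / (4 N)`. Since
trimming is a projection onto an interval containing the true preference probability, and the
empirical preference has standard deviation at most `1 / (2 √M)`, the bias of `Y` is at most `L /
(2 √M)` (`abs_integral_feedback_sub_le`). Second moments alone suffice here, so that no
logarithmic factor arises; the factor `√(log M)` in the rate is only used through its lower bound
`1 / 2`.

*The direction.* Write `X = ⟪∇V(θ), v⟫`. By smoothness `V(θ + μ v) - V(θ) = μ X + O(L μ²)`, and
the expected ascent for a given `v` is at least `α d (X² / 2 - L² (μ² + 1 / (M μ²) + 1 / (N μ²)))`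
(`ascent_lower_bound`), where `α ≤ 1 / (12 L d)` makes the second-order term harmless. The uniform
distribution on the sphere is invariant under isometries, hence `E X² = ‖∇V(θ)‖² / d`
(`integral_inner_sq_sphereUniform`), and the factor `d` cancels in the main term.

*The sum.* Summing the expected ascent (`le_integral_zpgStep_sub`) over the iterations telescopes,
and `0 ≤ V ≤ H` bounds the total. The choice of `μ` balances the error terms (`error_le_rate`).

Integrability is automatic: a smooth function with values in `[0, H]` has bounded gradient
(`LSmooth.norm_gradient_sq_le`); here `L > 0`, since the Lipschitz inverse link forces `2 H ≤ L`.
-/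

namespace ZPG

/-! ### Smooth functions -/

section Smooth

variable {d : ℕ} {L : ℝ≥0} {f : Param d → ℝ}

/-- Second-order Taylor estimate for a function with Lipschitz gradient. -/
lemma LSmooth.abs_sub_inner_le (hf : LSmooth L f) (x h : Param d) :
    |f (x + h) - f x - inner ℝ (gradient f x) h| ≤ L / 2 * ‖h‖ ^ 2 := by
  have hder : ∀ t : ℝ, HasDerivAt (fun t : ℝ => f (x + t • h) - f x - t * inner ℝ (gradient f x) h)
      (inner ℝ (gradient f (x + t • h)) h - inner ℝ (gradient f x) h) t := by
    intro t
    have h1 : HasDerivAt (fun t : ℝ => x + t • h) h t := by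
      simpa using ((hasDerivAt_id t).smul_const h).const_add x
    have h2 : HasFDerivAt f (fderiv ℝ f (x + t • h)) (x + t • h) := (hf.1 _).hasFDerivAt
    have h3 := h2.comp_hasDerivAt t h1
    rw [← inner_gradient_left] at h3
    have h4 : HasDerivAt (fun t : ℝ => t * inner ℝ (gradient f x) h)
        (inner ℝ (gradient f x) h) t := by
      simpa using (hasDerivAt_id t).mul_const (inner ℝ (gradient f x) h)
    exact (h3.sub_const (f x)).sub h4
  have hB : ∀ t : ℝ, HasDerivAt (fun t : ℝ => L / 2 * ‖h‖ ^ 2 * t ^ 2) (L * ‖h‖ ^ 2 * t) t := by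
    intro t
    refine ((hasDerivAt_pow 2 t).const_mul ((L : ℝ) / 2 * ‖h‖ ^ 2)).congr_deriv ?_
    norm_num
    ring
  have key := image_norm_le_of_norm_deriv_right_le_deriv_boundary (a := (0 : ℝ)) (b := 1)
    (fun t _ => (hder t).continuousAt.continuousWithinAt)
    (fun t _ => (hder t).hasDerivWithinAt) (by simp) hB ?_ (Set.right_mem_Icc.2 zero_le_one)
  · simpa using key
  · rintro t ⟨ht, -⟩
    rw [← inner_sub_left]
    refine (norm_inner_le_norm _ _).trans ?_
    have := hf.2.dist_le_mul (x + t • h) x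
    rw [dist_eq_norm, dist_eq_norm, add_sub_cancel_left, norm_smul, Real.norm_of_nonneg ht] at this
    calc _ ≤ L * (t * ‖h‖) * ‖h‖ := by gcongr
      _ = _ := by ring

/-- A function with values in `[0, B]` and `L`-Lipschitz gradient has bounded gradient: a gradient
step of length `‖∇f‖ / L` increases it by at least `‖∇f‖² / (2 L)`. -/
lemma LSmooth.norm_gradient_sq_le (hf : LSmooth L f) (hL : 0 < L) {B : ℝ}
    (h0 : ∀ x, 0 ≤ f x) (hB : ∀ x, f x ≤ B) (x : Param d) :
    ‖gradient f x‖ ^ 2 ≤ 2 * L * B := by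
  have hL' : (0 : ℝ) < L := hL
  have h := (abs_le.1 (hf.abs_sub_inner_le x ((L : ℝ)⁻¹ • gradient f x))).1
  rw [inner_smul_right, real_inner_self_eq_norm_sq, norm_smul, norm_inv,
    Real.norm_of_nonneg hL'.le] at h
  have h1 := h0 x
  have h2 := hB (x + (L : ℝ)⁻¹ • gradient f x)
  have h3 : (L : ℝ) / 2 * ((L : ℝ)⁻¹ * ‖gradient f x‖) ^ 2 = ‖gradient f x‖ ^ 2 / (2 * L) := by
    field_simp
  have h4 : (L : ℝ)⁻¹ * ‖gradient f x‖ ^ 2 = 2 * (‖gradient f x‖ ^ 2 / (2 * L)) := by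
    field_simp
  rw [h3, h4] at h
  have h5 : ‖gradient f x‖ ^ 2 / (2 * L) ≤ B := by linarith
  rw [div_le_iff₀ (by positivity)] at h5
  linarith

end Smooth

/-! ### The uniform distribution on the sphere -/

section Sphere

variable {d : ℕ}

/-- The measure of a Borel set under `sphereUniform` is, up to normalization, the Lebesgue measure
of the cone that it spans inside the unit ball. -/
lemma sphereUniform_apply {s : Set (Param d)} (hs : MeasurableSet s) :
    sphereUniform d s = ((volume : Measure (Param d)).toSphere Set.univ)⁻¹ *
      (d * volume (Set.image2 (fun (r : ℝ) (x : Param d) => r • x) (Set.Ioo (0 : ℝ) 1)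
        (s ∩ Metric.sphere 0 1))) := by
  have hs' : MeasurableSet (Subtype.val ⁻¹' s : Set (Metric.sphere (0 : Param d) 1)) :=
    measurable_subtype_coe hs
  rw [sphereUniform, Measure.map_apply measurable_subtype_coe hs, cond_apply MeasurableSet.univ,
    Set.univ_inter, Measure.toSphere_apply' _ hs', Subtype.image_preimage_coe, Set.inter_comm]
  simp [Set.image2_smul]

lemma sphereUniform_map_isometry (e : Param d ≃ₗᵢ[ℝ] Param d) :
    (sphereUniform d).map e = sphereUniform d := by
  ext s hs
  have he : Measurable e := e.continuous.measurable
  rw [Measure.map_apply he hs, sphereUniform_apply hs, sphereUniform_apply (he hs)]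
  congr 2
  symm
  rw [← e.measurePreserving.measure_preimage_equiv (f := e.toMeasurableEquiv)]
  congr 1
  ext x
  simp only [Set.mem_image2, Set.mem_inter_iff, Set.mem_preimage, mem_sphere_zero_iff_norm,
    LinearIsometryEquiv.coe_toMeasurableEquiv]
  constructor
  · rintro ⟨r, hr, y, ⟨hy, hy1⟩, hx⟩
    refine ⟨r, hr, e.symm y, ⟨by simpa using hy, by simpa using hy1⟩, ?_⟩
    apply e.injective
    simp [hx]
  · rintro ⟨r, hr, y, ⟨hy, hy1⟩, rfl⟩
    exact ⟨r, hr, e y, ⟨hy, by simpa using hy1⟩, by simp⟩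

lemma ae_norm_sphereUniform : ∀ᵐ v ∂(sphereUniform d), ‖v‖ = 1 := by
  rw [sphereUniform, ae_map_iff measurable_subtype_coe.aemeasurable
    (measurableSet_eq_fun measurable_norm measurable_const)]
  exact ae_of_all _ fun v => by simp

/-- The uniform distribution on the sphere is isotropic: its second-moment matrix is `I / d`. -/
lemma integral_inner_sq_sphereUniform [NeZero d] (G : Param d) :
    ∫ v, inner ℝ G v ^ 2 ∂(sphereUniform d) = ‖G‖ ^ 2 / d := by
  -- the integral depends on `G` only through its norm, by invariance under reflections
  have hinv : ∀ x y : Param d, ‖x‖ = ‖y‖ →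
      ∫ v, inner ℝ x v ^ 2 ∂(sphereUniform d) = ∫ v, inner ℝ y v ^ 2 ∂(sphereUniform d) := by
    intro x y hxy
    set e := (ℝ ∙ (x - y))ᗮ.reflection with he
    have hexy : e x = y := Submodule.reflection_sub hxy
    have hm : Continuous fun v : Param d => inner ℝ y v ^ 2 := by fun_prop
    conv_rhs => rw [← sphereUniform_map_isometry e]
    rw [integral_map e.continuous.measurable.aemeasurable hm.aestronglyMeasurable]
    refine integral_congr_ae (ae_of_all _ fun v => ?_)
    simp only
    rw [← hexy, LinearIsometryEquiv.inner_map_map]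
  have hsum : ∑ i : Fin d, ∫ v, inner ℝ (EuclideanSpace.single i ‖G‖) v ^ 2 ∂(sphereUniform d)
      = ‖G‖ ^ 2 := by
    rw [← integral_finsetSum]
    · calc _ = ∫ _, ‖G‖ ^ 2 ∂(sphereUniform d) := by
            refine integral_congr_ae ?_
            filter_upwards [ae_norm_sphereUniform] with v hv
            have h1 : ∑ i, v i ^ 2 = 1 := by
              have := EuclideanSpace.real_norm_sq_eq v
              rw [← this, hv, one_pow]
            simp [EuclideanSpace.inner_single_left, mul_pow, ← Finset.mul_sum, h1]
        _ = _ := by simp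
    · intro i _
      refine Integrable.of_bound (C := (‖G‖) ^ 2)
        (by fun_prop : Continuous fun v : Param d => _).aestronglyMeasurable ?_
      filter_upwards [ae_norm_sphereUniform] with v hv
      rw [norm_pow]
      gcongr
      refine (norm_inner_le_norm _ _).trans ?_
      simp [hv]
  have hall : ∀ i : Fin d, ∫ v, inner ℝ (EuclideanSpace.single i ‖G‖) v ^ 2 ∂(sphereUniform d)
      = ∫ v, inner ℝ G v ^ 2 ∂(sphereUniform d) := fun i => hinv _ _ (by simp)
  simp only [hall, Finset.sum_const, Finset.card_univ, Fintype.card_fin, nsmul_eq_mul] at hsum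
  rw [eq_div_iff (by exact_mod_cast NeZero.ne d), ← hsum, mul_comm]

end Sphere

/-! ### Means of independent samples -/

section Mean

variable {β : Type*} [MeasurableSpace β] (ν : Measure β) [IsProbabilityMeasure ν]

lemma integral_mean_pi {n : ℕ} (hn : n ≠ 0) {g : β → ℝ} (hg : Integrable g ν) :
    ∫ x, (∑ i, g (x i)) / n ∂(Measure.pi fun _ : Fin n => ν) = ∫ y, g y ∂ν := by
  rw [integral_div, integral_finsetSum]
  · have : ∀ i : Fin n, ∫ x : Fin n → β, g (x i) ∂(Measure.pi fun _ : Fin n => ν) = ∫ y, g y ∂ν :=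
      fun i => integral_comp_eval (μ := fun _ : Fin n => ν) hg.aestronglyMeasurable
    simp only [this, Finset.sum_const, Finset.card_univ, Fintype.card_fin, nsmul_eq_mul]
    field_simp
  · exact fun i _ => integrable_comp_eval (μ := fun _ : Fin n => ν) hg

/-- The mean of `n` independent copies of a variable with values in `[a, b]` has variance at most
`(b - a)² / (4 n)`. -/
lemma variance_mean_pi_le {n : ℕ} (hn : n ≠ 0) {g : β → ℝ} (hg : Measurable g) {a b : ℝ}
    (hab : ∀ y, g y ∈ Set.Icc a b) :
    Var[fun x => (∑ i, g (x i)) / n; Measure.pi fun _ : Fin n => ν] ≤ ((b - a) / 2) ^ 2 / n := by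
  have hn' : (0 : ℝ) < n := by exact_mod_cast Nat.pos_of_ne_zero hn
  have h1 := variance_sum_pi (μ := fun _ : Fin n => ν) (X := fun _ => g)
    (fun _ => memLp_of_bounded (ae_of_all _ hab) hg.aestronglyMeasurable 2)
  have h2 : (fun x : Fin n → β => (∑ i, g (x i)) / n)
      = fun x => (n : ℝ)⁻¹ * (∑ i, fun ω : Fin n → β => g (ω i)) x := by
    ext x
    simp [div_eq_inv_mul]
  rw [h2, variance_const_mul, h1]
  have h3 := variance_le_sq_of_bounded (μ := ν) (ae_of_all _ hab) hg.aemeasurable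
  simp only [Finset.sum_const, Finset.card_univ, Fintype.card_fin, nsmul_eq_mul]
  calc _ = Var[g; ν] / n := by field_simp
    _ ≤ _ := by gcongr

end Mean

section Value

variable {d H : ℕ} {S A : Type*} [MeasurableSpace S] [MeasurableSpace A]
  (𝓜 : EpisodicMDP S A H) (π : PolicyNetwork d S A)

/-! ### The value as an expected trajectory reward -/

lemma EpisodicMDP.integrable_reward (m : Measure (Traj S A H)) [IsFiniteMeasure m] :
    Integrable 𝓜.reward m :=
  .of_mem_Icc 0 H 𝓜.measurable_reward.aemeasurable (ae_of_all _ 𝓜.reward_mem)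

lemma integral_reward_trajKernel (θ : Param d) :
    ∫ τ, 𝓜.reward τ ∂(trajKernel 𝓜 π θ) = value 𝓜 π θ := by
  rw [trajKernel, Kernel.snd_apply, integral_map measurable_snd.aemeasurable
    𝓜.measurable_reward.aestronglyMeasurable, integral_compProd]
  · rfl
  · exact .of_mem_Icc 0 H (𝓜.measurable_reward.comp measurable_snd).aemeasurable
      (ae_of_all _ fun x => 𝓜.reward_mem x.2)

lemma value_mem_Icc (θ : Param d) : value 𝓜 π θ ∈ Set.Icc (0 : ℝ) H := by
  rw [← integral_reward_trajKernel]
  constructor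
  · exact integral_nonneg fun τ => (𝓜.reward_mem τ).1
  · calc _ ≤ ∫ _, (H : ℝ) ∂(trajKernel 𝓜 π θ) :=
          integral_mono (𝓜.integrable_reward _) (integrable_const _) fun τ => (𝓜.reward_mem τ).2
      _ = H := by simp

end Value

/-! ### The trimmed inverse link -/

section Link

variable {σ : ℝ → unitInterval} {σinv : ℝ → ℝ} {H : ℕ} {L : ℝ≥0}

lemma trim_mem_Icc {Δ : ℝ} (hΔ : Δ ≤ 1 - Δ) (a : ℝ) : trim a Δ ∈ Set.Icc Δ (1 - Δ) :=
  ⟨le_min (le_max_right _ _) hΔ, min_le_right _ _⟩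

/-- Trimming is the projection onto `[Δ, 1 - Δ]`, so it does not move away from the points of this
interval. -/
lemma abs_trim_sub_le {a q Δ : ℝ} (hq : q ∈ Set.Icc Δ (1 - Δ)) : |trim a Δ - q| ≤ |a - q| := by
  obtain ⟨h1, h2⟩ := hq
  calc |trim a Δ - q| = |min (max a Δ) (1 - Δ) - min (max q Δ) (1 - Δ)| := by
        rw [max_eq_left h1, min_eq_left h2, trim]
    _ ≤ |max a Δ - max q Δ| := abs_min_sub_min_le_max _ _ _ _ |>.trans (by simp)
    _ ≤ |a - q| := abs_max_sub_max_le_abs _ _ _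

lemma trimLevel_nonneg (σ : ℝ → unitInterval) (H : ℕ) : 0 ≤ trimLevel σ H :=
  le_min (σ _).2.1 (by linarith [(σ H).2.2])

lemma IsLink.mem_trim (hσ : IsLink σ H) {x : ℝ} (hx : x ∈ Set.Icc (-(H : ℝ)) H) :
    (σ x : ℝ) ∈ Set.Icc (trimLevel σ H) (1 - trimLevel σ H) := by
  have hH : -(H : ℝ) ≤ H := hx.1.trans hx.2
  have h1 : (σ (-H) : ℝ) ≤ σ x :=
    hσ.strictMono.monotoneOn (Set.left_mem_Icc.2 hH) hx hx.1
  have h2 : (σ x : ℝ) ≤ σ H :=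
    hσ.strictMono.monotoneOn hx (Set.right_mem_Icc.2 hH) hx.2
  have h3 : trimLevel σ H ≤ σ (-H) := min_le_left _ _
  have h4 : trimLevel σ H ≤ 1 - σ H := min_le_right _ _
  exact ⟨by linarith, by linarith⟩

lemma IsLink.half_mem_trim (hσ : IsLink σ H) :
    (1 / 2 : ℝ) ∈ Set.Icc (trimLevel σ H) (1 - trimLevel σ H) :=
  hσ.zero ▸ hσ.mem_trim (x := 0) ⟨by simp, by simp⟩

lemma IsLipschitzInverseLink.apply_half (hinv : IsLipschitzInverseLink σ σinv H L)
    (hσ : IsLink σ H) : σinv (1 / 2) = 0 := by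
  rw [← hσ.zero]
  exact hinv.left_inv 0 ⟨by simp, by simp⟩

/-- The inverse link is `L`-Lipschitz and vanishes at `1 / 2`, hence it is bounded by `L / 2`. -/
lemma IsLipschitzInverseLink.abs_apply_le (hinv : IsLipschitzInverseLink σ σinv H L)
    (hσ : IsLink σ H) {p : ℝ} (hp : p ∈ Set.Icc (trimLevel σ H) (1 - trimLevel σ H)) :
    |σinv p| ≤ L / 2 := by
  have h := hinv.lipschitz.dist_le_mul p hp _ hσ.half_mem_trim
  rw [hinv.apply_half hσ, Real.dist_eq, Real.dist_eq, sub_zero] at h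
  have h0 := trimLevel_nonneg σ H
  have h1 : |p - 1 / 2| ≤ 1 / 2 := abs_le.2 ⟨by linarith [hp.1], by linarith [hp.2]⟩
  calc _ ≤ (L : ℝ) * |p - 1 / 2| := h
    _ ≤ L * (1 / 2) := by gcongr
    _ = _ := by ring

/-- The Lipschitz constant is at least `2 H`, since the inverse link grows from `0` to `H` between
`1 / 2` and `σ(H)`. -/
lemma IsLipschitzInverseLink.two_mul_le (hinv : IsLipschitzInverseLink σ σinv H L)
    (hσ : IsLink σ H) : 2 * (H : ℝ) ≤ L := by
  have hH : (H : ℝ) ∈ Set.Icc (-(H : ℝ)) H :=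
    ⟨by linarith [Nat.cast_nonneg (α := ℝ) H], le_rfl⟩
  have h := hinv.abs_apply_le hσ (hσ.mem_trim hH)
  rw [hinv.left_inv _ hH, abs_of_nonneg (Nat.cast_nonneg H)] at h
  linarith

end Link

/-! ### Bias and variance of the estimated value differences -/

section Oracle

variable {d H : ℕ} {S A : Type*} [MeasurableSpace S] [MeasurableSpace A]
  (𝓜 : EpisodicMDP S A H) (π : PolicyNetwork d S A)
  {σ : ℝ → unitInterval} {σinv : ℝ → ℝ} {L : ℝ≥0}

lemma EpisodicMDP.reward_sub_mem (τ₀ τ₁ : Traj S A H) :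
    𝓜.reward τ₁ - 𝓜.reward τ₀ ∈ Set.Icc (-(H : ℝ)) H := by
  have h0 := 𝓜.reward_mem τ₀
  have h1 := 𝓜.reward_mem τ₁
  exact ⟨by linarith [h0.2, h1.1], by linarith [h0.1, h1.2]⟩

lemma abs_inverseLink_preferenceEstimate_le (hσ : IsLink σ H)
    (hinv : IsLipschitzInverseLink σ σinv H L) {M : ℕ} (o : Fin M → Bool) :
    |σinv (preferenceEstimate (trimLevel σ H) o)| ≤ L / 2 :=
  hinv.abs_apply_le hσ (trim_mem_Icc (hσ.half_mem_trim.1.trans hσ.half_mem_trim.2) _)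

/-- With `M` evaluations of a pair of trajectories, the estimated reward difference has bias at most
`L / (2 √M)`: the trimmed inverse link is `L`-Lipschitz, and the empirical preference has variance
at most `1 / (4 M)`. -/
lemma abs_integral_feedback_sub_le (hσ : IsLink σ H) (hinv : IsLipschitzInverseLink σ σinv H L)
    {M : ℕ} (hM : M ≠ 0) (x : Traj S A H × Traj S A H) :
    |∫ o, σinv (preferenceEstimate (trimLevel σ H) o) ∂(iid (feedback 𝓜 hσ.measurable) M x)
      - (𝓜.reward x.2 - 𝓜.reward x.1)| ≤ L / (2 * √M) := by
  have hM' : (0 : ℝ) < M := by exact_mod_cast Nat.pos_of_ne_zero hM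
  set ν := feedback 𝓜 hσ.measurable x with hν
  set m := iid (feedback 𝓜 hσ.measurable) M x with hm
  set g : Bool → ℝ := fun b => if b then 1 else 0 with hg
  set q : ℝ := ((σ (𝓜.reward x.2 - 𝓜.reward x.1) : unitInterval) : ℝ) with hq
  have hmpi : m = Measure.pi fun _ : Fin M => ν := rfl
  have hgm : Measurable g := measurable_of_finite g
  have hg01 : ∀ b, g b ∈ Set.Icc (0 : ℝ) 1 := by intro b; cases b <;> simp [hg]
  have hgint : ∫ b, g b ∂ν = q := by
    have : ν = bernoulliMeasure true false (σ (𝓜.reward x.2 - 𝓜.reward x.1)) := rfl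
    rw [this, integral_bernoulliMeasure]
    simp [hg, hq]
  have hqmem := hσ.mem_trim (𝓜.reward_sub_mem x.1 x.2)
  set avg : (Fin M → Bool) → ℝ := fun o => (∑ i, g (o i)) / M with havg
  have hmean : ∫ o, avg o ∂m = q := by
    rw [hmpi, havg, integral_mean_pi ν hM (.of_mem_Icc 0 1 hgm.aemeasurable (ae_of_all _ hg01)),
      hgint]
  have hvar : ∫ o, (avg o - q) ^ 2 ∂m ≤ 1 / (4 * M) := by
    have h := variance_mean_pi_le ν hM hgm hg01
    rw [variance_eq_integral (measurable_of_finite _).aemeasurable, ← hmpi] at h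
    simp only [havg] at hmean ⊢
    rw [hmean] at h
    refine h.trans (le_of_eq ?_)
    norm_num
    field_simp
  -- the first absolute moment is at most the square root of the second moment
  have habs : ∫ o, |avg o - q| ∂m ≤ 1 / (2 * √M) := by
    refine (Real.le_sqrt_of_sq_le (y := 1 / (4 * M)) (le_trans ?_ hvar)).trans (le_of_eq ?_)
    · have := variance_nonneg (fun o => |avg o - q|) m
      rw [variance_eq_sub (MemLp.of_discrete)] at this
      simp only [Pi.pow_apply, sq_abs] at this
      linarith
    · rw [Real.sqrt_div zero_le_one, Real.sqrt_mul (by norm_num), Real.sqrt_one,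
        show (4 : ℝ) = 2 ^ 2 by norm_num, Real.sqrt_sq (by norm_num)]
  have hpt : ∀ o, |σinv (preferenceEstimate (trimLevel σ H) o)
      - (𝓜.reward x.2 - 𝓜.reward x.1)| ≤ L * |avg o - q| := by
    intro o
    have h1 : preferenceEstimate (trimLevel σ H) o = trim (avg o) (trimLevel σ H) := by
      simp only [preferenceEstimate, havg, hg, Finset.sum_div]
    have h2 : 𝓜.reward x.2 - 𝓜.reward x.1 = σinv q :=
      (hinv.left_inv _ (𝓜.reward_sub_mem x.1 x.2)).symm
    rw [h1, h2, ← Real.dist_eq]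
    refine (hinv.lipschitz.dist_le_mul _
      (trim_mem_Icc (hqmem.1.trans hqmem.2) _) _ hqmem).trans ?_
    exact mul_le_mul_of_nonneg_left (abs_trim_sub_le hqmem) L.2
  calc _ = |∫ o, (σinv (preferenceEstimate (trimLevel σ H) o)
        - (𝓜.reward x.2 - 𝓜.reward x.1)) ∂m| := by
        rw [integral_sub .of_finite (integrable_const _)]; simp
    _ ≤ ∫ o, |σinv (preferenceEstimate (trimLevel σ H) o)
        - (𝓜.reward x.2 - 𝓜.reward x.1)| ∂m := abs_integral_le_integral_abs
    _ ≤ ∫ o, L * |avg o - q| ∂m := integral_mono .of_finite .of_finite hpt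
    _ = L * ∫ o, |avg o - q| ∂m := integral_const_mul _ _
    _ ≤ L * (1 / (2 * √M)) := by gcongr
    _ = _ := by ring

lemma measurable_inverseLink_preferenceEstimate {β : Type*} [MeasurableSpace β] (Δ : ℝ) (M : ℕ) :
    Measurable fun z : β × (Fin M → Bool) => σinv (preferenceEstimate Δ z.2) :=
  (measurable_of_finite fun o : Fin M → Bool => σinv (preferenceEstimate Δ o)).comp measurable_snd

/-- One inner iteration estimates `V(π_θ') - V(π_θ)` with bias at most `L / (2 √M)`. -/
lemma abs_integral_pairQuery_sub_le (hσ : IsLink σ H) (hinv : IsLipschitzInverseLink σ σinv H L)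
    {M : ℕ} (hM : M ≠ 0) (θ θ' : Param d) :
    |∫ z, σinv (preferenceEstimate (trimLevel σ H) z.2) ∂(pairQuery 𝓜 π hσ.measurable M (θ, θ'))
      - (value 𝓜 π θ' - value 𝓜 π θ)| ≤ L / (2 * √M) := by
  set m := (trajKernel 𝓜 π θ).prod (trajKernel 𝓜 π θ') with hm
  have hrew : Integrable (fun x : Traj S A H × Traj S A H => 𝓜.reward x.2 - 𝓜.reward x.1) m :=
    ((𝓜.integrable_reward _).comp_snd _).sub ((𝓜.integrable_reward _).comp_fst _)
  have hval : value 𝓜 π θ' - value 𝓜 π θ = ∫ x, (𝓜.reward x.2 - 𝓜.reward x.1) ∂m := by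
    rw [integral_sub ((𝓜.integrable_reward _).comp_snd _) ((𝓜.integrable_reward _).comp_fst _),
      integral_fun_snd, integral_fun_fst]
    simp [integral_reward_trajKernel]
  have hint : Integrable (fun z => σinv (preferenceEstimate (trimLevel σ H) z.2))
      (pairQuery 𝓜 π hσ.measurable M (θ, θ')) :=
    .of_bound (measurable_inverseLink_preferenceEstimate _ M).aestronglyMeasurable (L / 2)
      (ae_of_all _ fun z => abs_inverseLink_preferenceEstimate_le hσ hinv z.2)
  have hcomp : ∫ z, σinv (preferenceEstimate (trimLevel σ H) z.2)
      ∂(pairQuery 𝓜 π hσ.measurable M (θ, θ')) = ∫ x, (∫ o, σinv (preferenceEstimate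
        (trimLevel σ H) o) ∂(iid (feedback 𝓜 hσ.measurable) M x)) ∂m := by
    unfold pairQuery at hint ⊢
    rw [integral_compProd hint, Kernel.prod_apply]
    rfl
  have hint' : Integrable (fun x => ∫ o, σinv (preferenceEstimate
        (trimLevel σ H) o) ∂(iid (feedback 𝓜 hσ.measurable) M x)) m := by
    unfold pairQuery at hint
    have := hint.integral_compProd
    rw [Kernel.prod_apply] at this
    exact this
  rw [hcomp, hval, ← integral_sub hint' hrew]
  rw [← Real.norm_eq_abs]
  refine (norm_integral_le_of_norm_le_const (C := (L : ℝ) / (2 * √M)) (ae_of_all _ fun x =>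
    (Real.norm_eq_abs _).trans_le (abs_integral_feedback_sub_le 𝓜 hσ hinv hM x))).trans ?_
  simp

/-- The average of the estimated reward differences over the `N` inner iterations. Only the second
components, the `M` answers of each iteration, matter. -/
noncomputable def valueDiffEstimate {β : Type*} (σinv : ℝ → ℝ) (Δ : ℝ) {N M : ℕ}
    (z : Fin N → β × (Fin M → Bool)) : ℝ :=
  (∑ n, σinv (preferenceEstimate Δ (z n).2)) / N

lemma measurable_valueDiffEstimate {β : Type*} [MeasurableSpace β] (Δ : ℝ) (N M : ℕ) :
    Measurable (valueDiffEstimate σinv Δ : (Fin N → β × (Fin M → Bool)) → ℝ) :=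
  (Finset.measurable_sum _ fun n _ => (measurable_inverseLink_preferenceEstimate (σinv := σinv)
    Δ M).comp (measurable_pi_apply n)).div_const _

lemma abs_valueDiffEstimate_le {β : Type*} (hσ : IsLink σ H)
    (hinv : IsLipschitzInverseLink σ σinv H L) {N M : ℕ} (hN : N ≠ 0)
    (z : Fin N → β × (Fin M → Bool)) :
    |valueDiffEstimate σinv (trimLevel σ H) z| ≤ L / 2 := by
  have hN' : (0 : ℝ) < N := by exact_mod_cast Nat.pos_of_ne_zero hN
  rw [valueDiffEstimate, abs_div, Nat.abs_cast, div_le_iff₀ hN']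
  refine (Finset.abs_sum_le_sum_abs _ _).trans ?_
  refine (Finset.sum_le_sum fun n _ =>
    abs_inverseLink_preferenceEstimate_le hσ hinv (z n).2).trans ?_
  simp [mul_comm]

lemma abs_integral_valueDiffEstimate_sub_le (hσ : IsLink σ H)
    (hinv : IsLipschitzInverseLink σ σinv H L) {N M : ℕ} (hN : N ≠ 0) (hM : M ≠ 0)
    (θ θ' : Param d) :
    |∫ z, valueDiffEstimate σinv (trimLevel σ H) z
        ∂(iid (pairQuery 𝓜 π hσ.measurable M) N (θ, θ'))
      - (value 𝓜 π θ' - value 𝓜 π θ)| ≤ L / (2 * √M) := by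
  refine le_of_eq_of_le ?_ (abs_integral_pairQuery_sub_le 𝓜 π hσ hinv hM θ θ')
  congr 2
  exact integral_mean_pi (pairQuery 𝓜 π hσ.measurable M (θ, θ')) hN
    (.of_bound (measurable_inverseLink_preferenceEstimate _ M).aestronglyMeasurable (L / 2)
      (ae_of_all _ fun z => abs_inverseLink_preferenceEstimate_le hσ hinv z.2))

/-- The second moment of the averaged estimate: its variance is at most `L² / (4 N)`, as each of the
`N` independent terms has absolute value at most `L / 2`. -/
lemma integral_valueDiffEstimate_sq_le (hσ : IsLink σ H)
    (hinv : IsLipschitzInverseLink σ σinv H L) {N M : ℕ} (hN : N ≠ 0) (x : Param d × Param d) :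
    ∫ z, valueDiffEstimate σinv (trimLevel σ H) z ^ 2
        ∂(iid (pairQuery 𝓜 π hσ.measurable M) N x)
      ≤ L ^ 2 / (4 * N) + (∫ z, valueDiffEstimate σinv (trimLevel σ H) z
        ∂(iid (pairQuery 𝓜 π hσ.measurable M) N x)) ^ 2 := by
  have h := variance_mean_pi_le (pairQuery 𝓜 π hσ.measurable M x) hN
    (measurable_inverseLink_preferenceEstimate (σinv := σinv) (trimLevel σ H) M)
    (fun z => abs_le.1 (abs_inverseLink_preferenceEstimate_le hσ hinv z.2))
  change Var[valueDiffEstimate σinv (trimLevel σ H);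
    iid (pairQuery 𝓜 π hσ.measurable M) N x] ≤ _ at h
  rw [variance_eq_sub (memLp_of_bounded
    (ae_of_all _ fun z => abs_le.1 (abs_valueDiffEstimate_le hσ hinv hN z))
    (measurable_valueDiffEstimate _ N M).aestronglyMeasurable 2)] at h
  have h2 : (((L : ℝ) / 2 - -(L / 2)) / 2) ^ 2 / N = L ^ 2 / (4 * N) := by
    field_simp
    ring
  rw [h2] at h
  simp only [Pi.pow_apply] at h
  linarith

end Oracle

/-! ### Expected ascent in one iteration -/

/-- Expected ascent along a fixed direction `v`, with `X = ⟪∇V, v⟫` and `m` the mean of the estimate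
of `V(θ + μ v) - V(θ)`: the first-order gain is at least the part `α d X² / 2` up to the bias of
`m` and the second-order term. -/
lemma ascent_lower_bound {X m α μ D L N M : ℝ} (hμ : 0 < μ) (hα : 0 ≤ α) (hD : 0 ≤ D)
    (hN : 0 < N) (hM : 0 < M) (hstep : L * (α * D) ≤ 1 / 12)
    (hm : |m - μ * X| ≤ L / 2 * μ ^ 2 + L / (2 * √M)) :
    α * D * (X ^ 2 / 2 - L ^ 2 * (μ ^ 2 + 1 / (M * μ ^ 2) + 1 / (N * μ ^ 2))) ≤
      α * D / μ * m * X - L / 2 * (α * D / μ) ^ 2 * (L ^ 2 / (4 * N) + m ^ 2) := by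
  set b := m - μ * X with hb
  have hm' : m = μ * X + b := by rw [hb]; ring
  have hs : (√M) ^ 2 = M := Real.sq_sqrt hM.le
  have hb2 : b ^ 2 ≤ L ^ 2 * μ ^ 4 / 2 + L ^ 2 / (2 * M) := by
    have h1 : b ^ 2 ≤ (L / 2 * μ ^ 2 + L / (2 * √M)) ^ 2 := sq_le_sq' (abs_le.1 hm).1 (abs_le.1 hm).2
    have h2 : (L / (2 * √M)) ^ 2 = L ^ 2 / (4 * M) := by
      rw [div_pow, mul_pow, hs]; norm_num
    have h3 := add_sq_le (a := L / 2 * μ ^ 2) (b := L / (2 * √M))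
    rw [h2] at h3
    refine h1.trans (h3.trans (le_of_eq ?_))
    field_simp
    ring
  -- `e` is the bias of `m / μ` as an estimate of `X`
  set e := b / μ with he
  have hbe : b = μ * e := by rw [he]; field_simp
  have he2 : e ^ 2 ≤ L ^ 2 * (μ ^ 2 / 2 + 1 / (2 * (M * μ ^ 2))) := by
    rw [he, div_pow, div_le_iff₀ (by positivity)]
    refine hb2.trans (le_of_eq ?_)
    field_simp
  have hβ : 0 ≤ α * D := mul_nonneg hα hD
  have hrw : α * D / μ * m * X - L / 2 * (α * D / μ) ^ 2 * (L ^ 2 / (4 * N) + m ^ 2) =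
      α * D * ((X + e) * X
        - L * (α * D) / 2 * (L ^ 2 * (1 / (N * μ ^ 2)) / 4 + (X + e) ^ 2)) := by
    rw [hm', hbe]
    field_simp
  rw [hrw]
  refine mul_le_mul_of_nonneg_left ?_ hβ
  have h4 : L * (α * D) / 2 * (L ^ 2 * (1 / (N * μ ^ 2)) / 4 + (X + e) ^ 2) ≤
      1 / 24 * (L ^ 2 * (1 / (N * μ ^ 2)) / 4 + (X + e) ^ 2) := by
    refine mul_le_mul_of_nonneg_right (by linarith) (by positivity)
  have h5 : 0 ≤ L ^ 2 * (1 / (N * μ ^ 2)) := by positivity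
  have h6 : 0 ≤ L ^ 2 * (1 / (M * μ ^ 2)) := by positivity
  have h7 : 0 ≤ L ^ 2 * μ ^ 2 := by positivity
  have he2' : e ^ 2 ≤ L ^ 2 * μ ^ 2 / 2 + L ^ 2 * (1 / (M * μ ^ 2)) / 2 := by
    refine he2.trans (le_of_eq ?_)
    field_simp
  nlinarith [sq_nonneg (X + 2 * e), sq_nonneg (X - e)]

section Step

variable {d H : ℕ} {S A : Type*} [MeasurableSpace S] [MeasurableSpace A]
  (𝓜 : EpisodicMDP S A H) (π : PolicyNetwork d S A)
  {σ : ℝ → unitInterval} {σinv : ℝ → ℝ} {L : ℝ≥0}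

/-- The joint law of the direction and the query results in one iteration started at `θ`. -/
noncomputable def roundLaw (hσ : Measurable σ) (N M : ℕ) (μ : ℝ) :
    Kernel (Param d) (Param d × (Fin N → (Traj S A H × Traj S A H) × (Fin M → Bool))) :=
  Kernel.const (Param d) (sphereUniform d) ⊗ₖ
    (iid (pairQuery 𝓜 π hσ M) N).comap (fun x => (x.1, x.1 + μ • x.2)) (by fun_prop)

instance [NeZero d] (hσ : Measurable σ) (N M : ℕ) (μ : ℝ) :
    IsMarkovKernel (roundLaw 𝓜 π hσ N M μ) := by
  unfold roundLaw; infer_instance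

lemma integral_zpgStep [NeZero d] (hσ : Measurable σ) (N M : ℕ) (α μ : ℝ) (θ : Param d)
    {f : Param d → ℝ} (hf : Measurable f) :
    ∫ θ', f θ' ∂(zpgStep 𝓜 π hσ σinv N M α μ θ) =
      ∫ x, f (θ + (α * d / μ * valueDiffEstimate σinv (trimLevel σ H) x.2) • x.1)
        ∂(roundLaw 𝓜 π hσ N M μ θ) := by
  have hmeas := measurable_update (d := d) (S := S) (A := A) (H := H) σinv (trimLevel σ H) α μ N M
  have hcomp := hf.comp hmeas
  simp only [Function.comp_def] at hcomp
  unfold zpgStep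
  rw [Kernel.map_apply _ hmeas, integral_map hmeas.aemeasurable hf.aestronglyMeasurable,
    Kernel.prod_apply, Kernel.id_apply, Measure.dirac_prod,
    integral_map measurable_prodMk_left.aemeasurable hcomp.aestronglyMeasurable]
  refine integral_congr_ae (ae_of_all _ fun x => ?_)
  simp only [gradEstimate, valueDiffEstimate, smul_smul]
  ring_nf

/-- One iteration increases the value by `α ‖∇V‖² / 2` on average, up to an error made of the
smoothing bias, the bias of the human feedback and the variance of the estimate. -/
lemma le_integral_zpgStep_sub [NeZero d] (hσ : IsLink σ H)
    (hinv : IsLipschitzInverseLink σ σinv H L) (hV : LSmooth L (value 𝓜 π))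
    {N M : ℕ} (hN : N ≠ 0) (hM : M ≠ 0) {α μ : ℝ} (hα : 0 ≤ α) (hμ : 0 < μ)
    (hstep : L * (α * d) ≤ 1 / 12) (θ : Param d) :
    α * (‖gradient (value 𝓜 π) θ‖ ^ 2 / 2
        - d * (L ^ 2 * (μ ^ 2 + 1 / (M * μ ^ 2) + 1 / (N * μ ^ 2)))) ≤
      ∫ θ', value 𝓜 π θ' ∂(zpgStep 𝓜 π hσ.measurable σinv N M α μ θ) - value 𝓜 π θ := by
  set V := value 𝓜 π with hVdef
  set G := gradient V θ with hG
  set E : ℝ := L ^ 2 * (μ ^ 2 + 1 / (M * μ ^ 2) + 1 / (N * μ ^ 2)) with hE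
  set c : ℝ := α * d / μ with hc
  have hVm : Measurable V := hV.1.continuous.measurable
  have hYm := measurable_valueDiffEstimate (σinv := σinv) (β := Traj S A H × Traj S A H)
    (trimLevel σ H) N M
  have hupd : Measurable fun x : Param d × (Fin N → (Traj S A H × Traj S A H) × (Fin M → Bool)) =>
      V (θ + (c * valueDiffEstimate σinv (trimLevel σ H) x.2) • x.1) :=
    hVm.comp (measurable_const.add (((hYm.comp measurable_snd).const_mul c).smul measurable_fst))
  have hint : Integrable (fun x => V (θ + (c * valueDiffEstimate σinv (trimLevel σ H) x.2) • x.1))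
      (roundLaw 𝓜 π hσ.measurable N M μ θ) :=
    .of_mem_Icc 0 H hupd.aemeasurable (ae_of_all _ fun x => value_mem_Icc 𝓜 π _)
  rw [integral_zpgStep 𝓜 π _ N M α μ θ hVm]
  have hsplit := integral_compProd hint
  have houter := hint.integral_compProd
  change ∫ x, _ ∂(roundLaw 𝓜 π hσ.measurable N M μ θ) = _ at hsplit
  rw [hsplit]
  have hX2 : Integrable (fun v => inner ℝ G v ^ 2) (sphereUniform d) := by
    refine Integrable.of_bound (C := ‖G‖ ^ 2)
      (by fun_prop : Continuous fun v : Param d => inner ℝ G v ^ 2).aestronglyMeasurable ?_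
    filter_upwards [ae_norm_sphereUniform] with v hv
    rw [norm_pow]
    gcongr
    exact (norm_inner_le_norm _ _).trans (by simp [hv])
  have hXE : Integrable (fun v => α * d * (inner ℝ G v ^ 2 / 2 - E)) (sphereUniform d) :=
    ((hX2.div_const 2).sub (integrable_const E)).const_mul _
  have hlow : ∫ v, (V θ + α * d * (inner ℝ G v ^ 2 / 2 - E)) ∂(sphereUniform d)
      = V θ + α * (‖G‖ ^ 2 / 2 - d * E) := by
    rw [integral_add (integrable_const _) hXE,
      integral_const_mul, integral_sub (hX2.div_const 2) (integrable_const _), integral_div,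
      integral_inner_sq_sphereUniform]
    have hd : (d : ℝ) ≠ 0 := by exact_mod_cast NeZero.ne d
    simp only [integral_const, probReal_univ, one_smul]
    field_simp
  rw [le_sub_iff_add_le', ← hlow]
  refine integral_mono_ae
    ((integrable_const _).add hXE) houter ?_
  filter_upwards [ae_norm_sphereUniform] with v hv
  set Q := iid (pairQuery 𝓜 π hσ.measurable M) N (θ, θ + μ • v) with hQ
  have hY1 : Integrable (valueDiffEstimate σinv (trimLevel σ H)) Q :=
    .of_bound hYm.aestronglyMeasurable (L / 2)
      (ae_of_all _ fun z => abs_valueDiffEstimate_le hσ hinv hN z)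
  have hY2 : Integrable (fun z => valueDiffEstimate σinv (trimLevel σ H) z ^ 2) Q := by
    refine .of_bound (hYm.pow_const 2).aestronglyMeasurable ((L / 2) ^ 2) (ae_of_all _ fun z => ?_)
    rw [norm_pow]
    gcongr
    exact abs_valueDiffEstimate_le hσ hinv hN z
  have hVint : Integrable
      (fun z => V (θ + (c * valueDiffEstimate σinv (trimLevel σ H) z) • v)) Q :=
    .of_mem_Icc 0 H (hupd.comp measurable_prodMk_left).aemeasurable
      (ae_of_all _ fun x => value_mem_Icc 𝓜 π _)
  set X := inner ℝ G v with hX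
  set m := ∫ z, valueDiffEstimate σinv (trimLevel σ H) z ∂Q with hm
  have hbias : |m - μ * X| ≤ L / 2 * μ ^ 2 + L / (2 * √M) := by
    have h1 := abs_integral_valueDiffEstimate_sub_le 𝓜 π hσ hinv hN hM θ (θ + μ • v)
    have h2 := hV.abs_sub_inner_le θ (μ • v)
    rw [inner_smul_right, norm_smul, hv, mul_one, Real.norm_of_nonneg hμ.le] at h2
    calc |m - μ * X| = |(V (θ + μ • v) - V θ - μ * X) + (m - (V (θ + μ • v) - V θ))| := by
          congr 1; ring
      _ ≤ _ := (abs_add_le _ _).trans (add_le_add h2 h1)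
  have hsq := integral_valueDiffEstimate_sq_le 𝓜 π hσ hinv (M := M) hN (θ, θ + μ • v)
  rw [← hQ, ← hm] at hsq
  have halg := ascent_lower_bound (X := X) (m := m) (D := d) (N := N) (M := M) hμ hα
    (Nat.cast_nonneg d) (by exact_mod_cast Nat.pos_of_ne_zero hN)
    (by exact_mod_cast Nat.pos_of_ne_zero hM) hstep hbias
  change α * d * (X ^ 2 / 2 - E) ≤ c * m * X - L / 2 * c ^ 2 * _ at halg
  have hpt : ∀ z : Fin N → (Traj S A H × Traj S A H) × (Fin M → Bool), V θ + c * X * valueDiffEstimate σinv (trimLevel σ H) z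
      - L / 2 * c ^ 2 * valueDiffEstimate σinv (trimLevel σ H) z ^ 2 ≤
      V (θ + (c * valueDiffEstimate σinv (trimLevel σ H) z) • v) := by
    intro z
    have h := (abs_le.1 (hV.abs_sub_inner_le θ
      ((c * valueDiffEstimate σinv (trimLevel σ H) z) • v))).1
    rw [inner_smul_right, norm_smul, hv, mul_one, Real.norm_eq_abs, sq_abs] at h
    change _ ≤ _ - _ - _ * X at h
    linarith
  have hlin : Integrable
      (fun z => V θ + c * X * valueDiffEstimate σinv (trimLevel σ H) z) Q :=
    (integrable_const _).add (hY1.const_mul _)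
  calc V θ + α * d * (X ^ 2 / 2 - E)
      ≤ V θ + c * X * m - L / 2 * c ^ 2 * ∫ z, valueDiffEstimate σinv (trimLevel σ H) z ^ 2 ∂Q := by
        have : L / 2 * c ^ 2 * ∫ z, valueDiffEstimate σinv (trimLevel σ H) z ^ 2 ∂Q ≤
          L / 2 * c ^ 2 * (L ^ 2 / (4 * N) + m ^ 2) := by gcongr
        linarith
    _ = ∫ z, (V θ + c * X * valueDiffEstimate σinv (trimLevel σ H) z
          - L / 2 * c ^ 2 * valueDiffEstimate σinv (trimLevel σ H) z ^ 2) ∂Q := by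
        rw [integral_sub hlin (hY2.const_mul _),
          integral_add (integrable_const _) (hY1.const_mul _), integral_const_mul,
          integral_const_mul]
        simp [hm]
    _ ≤ _ := integral_mono (hlin.sub (hY2.const_mul _)) hVint hpt

end Step

/-! ### The law of the iterates -/

section Path

variable {d H : ℕ} [NeZero d] {S A : Type*} [MeasurableSpace S] [MeasurableSpace A]
  (𝓜 : EpisodicMDP S A H) (π : PolicyNetwork d S A)
  {σ : ℝ → unitInterval} (hσ : Measurable σ) (σinv : ℝ → ℝ) (N M : ℕ) (α μ : ℝ) (θ₀ : Param d)

instance isProbabilityMeasure_zpgPath (t : ℕ) :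
    IsProbabilityMeasure (zpgPath 𝓜 π hσ σinv N M α μ θ₀ t) := by
  induction t with
  | zero => unfold zpgPath; infer_instance
  | succ t ih =>
    unfold zpgPath
    exact Measure.isProbabilityMeasure_map (measurable_snoc (t + 1)).aemeasurable

/-- The law of the iterate `θ_t`. -/
noncomputable def iterateLaw (t : ℕ) : Measure (Param d) :=
  (zpgPath 𝓜 π hσ σinv N M α μ θ₀ t).map fun p => p (Fin.last t)

instance (t : ℕ) : IsProbabilityMeasure (iterateLaw 𝓜 π hσ σinv N M α μ θ₀ t) :=
  Measure.isProbabilityMeasure_map (measurable_pi_apply _).aemeasurable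

lemma zpgPath_map_eval (t : ℕ) (i : Fin (t + 1)) :
    (zpgPath 𝓜 π hσ σinv N M α μ θ₀ t).map (fun p => p i)
      = iterateLaw 𝓜 π hσ σinv N M α μ θ₀ i := by
  induction t with
  | zero =>
    obtain rfl : i = Fin.last 0 := Fin.ext (by have := i.2; rw [Fin.val_last]; omega)
    rfl
  | succ t ih =>
    refine Fin.lastCases rfl (fun j => ?_) i
    rw [Fin.val_castSucc, ← ih j]
    conv_lhs => unfold zpgPath
    rw [Measure.map_map (measurable_pi_apply _) (measurable_snoc (t + 1))]
    conv_rhs => rw [← Measure.fst_compProd (zpgPath 𝓜 π hσ σinv N M α μ θ₀ t)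
      ((zpgStep 𝓜 π hσ σinv N M α μ).comap (fun p => p (Fin.last t)) (by fun_prop)),
      Measure.fst, Measure.map_map (measurable_pi_apply _) measurable_fst]
    congr 1
    ext x : 1
    simp

lemma integral_iterateLaw_succ (t : ℕ) {f : Param d → ℝ} (hf : Measurable f) {C : ℝ}
    (hC : ∀ θ, |f θ| ≤ C) :
    ∫ θ, f θ ∂(iterateLaw 𝓜 π hσ σinv N M α μ θ₀ (t + 1)) =
      ∫ θ, ∫ θ', f θ' ∂(zpgStep 𝓜 π hσ σinv N M α μ θ)
        ∂(iterateLaw 𝓜 π hσ σinv N M α μ θ₀ t) := by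
  have hsm : StronglyMeasurable fun θ => ∫ θ', f θ' ∂(zpgStep 𝓜 π hσ σinv N M α μ θ) :=
    hf.stronglyMeasurable.integral_kernel
  have hlast : ∀ s : ℕ, Measurable fun p : Fin (s + 1) → Param d => p (Fin.last s) :=
    fun s => measurable_pi_apply _
  rw [iterateLaw, iterateLaw, integral_map (hlast _).aemeasurable hf.aestronglyMeasurable,
    integral_map (hlast _).aemeasurable hsm.aestronglyMeasurable]
  conv_lhs => unfold zpgPath
  rw [integral_map (measurable_snoc (t + 1)).aemeasurable
    (f := fun p : Fin (t + 1 + 1) → Param d => f (p (Fin.last (t + 1))))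
    (hf.comp (hlast _)).aestronglyMeasurable]
  simp only [Fin.snoc_last]
  rw [Measure.integral_compProd (f := fun x => f x.2) (.of_bound (hf.comp measurable_snd).aestronglyMeasurable C
    (ae_of_all _ fun x => hC x.2))]
  rfl

/-- The output is the iterate with a uniformly random index. -/
lemma integral_zpgOutput {T : ℕ} (hT : T ≠ 0) {f : Param d → ℝ} (hf : Measurable f) {C : ℝ}
    (hC : ∀ θ, |f θ| ≤ C) :
    ∫ θ, f θ ∂(zpgOutput 𝓜 π hσ σinv N M α μ θ₀ T) =
      (∑ t ∈ Finset.range T, ∫ θ, f θ ∂(iterateLaw 𝓜 π hσ σinv N M α μ θ₀ t)) / T := by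
  have : NeZero T := ⟨hT⟩
  have : IsProbabilityMeasure (uniformOn (Set.univ : Set (Fin T))) :=
    isProbabilityMeasure_uniformOn Set.finite_univ Set.univ_nonempty
  have hev : Measurable fun x : (Fin (T + 1) → Param d) × Fin T => x.1 x.2.castSucc :=
    measurable_from_prod_countable_left fun i =>
      (measurable_pi_apply i.castSucc : Measurable fun p : Fin (T + 1) → Param d => p i.castSucc)
  have hfev : Integrable (fun x : (Fin (T + 1) → Param d) × Fin T => f (x.1 x.2.castSucc))
      ((zpgPath 𝓜 π hσ σinv N M α μ θ₀ T).prod (uniformOn Set.univ)) :=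
    .of_bound (hf.comp hev).aestronglyMeasurable C (ae_of_all _ fun x => hC _)
  rw [zpgOutput, integral_map hev.aemeasurable hf.aestronglyMeasurable, integral_prod_symm _ hfev,
    integral_fintype .of_finite, Finset.sum_div, ← Fin.sum_univ_eq_sum_range
      (fun t => (∫ θ, f θ ∂(iterateLaw 𝓜 π hσ σinv N M α μ θ₀ t)) / T)]
  refine Finset.sum_congr rfl fun i _ => ?_
  have h1 : (uniformOn (Set.univ : Set (Fin T))).real {i} = 1 / T := by
    rw [measureReal_def, uniformOn_univ]
    simp
  rw [h1, ← integral_map (f := f) (φ := fun p : Fin (T + 1) → Param d => p i.castSucc)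
    (measurable_pi_apply _).aemeasurable hf.aestronglyMeasurable, zpgPath_map_eval]
  simp [div_eq_inv_mul]

instance isProbabilityMeasure_zpgOutput (T : ℕ) [NeZero T] :
    IsProbabilityMeasure (zpgOutput 𝓜 π hσ σinv N M α μ θ₀ T) := by
  have : IsProbabilityMeasure (uniformOn (Set.univ : Set (Fin T))) :=
    isProbabilityMeasure_uniformOn Set.finite_univ Set.univ_nonempty
  exact Measure.isProbabilityMeasure_map
    (measurable_from_prod_countable_left fun i =>
      (measurable_pi_apply i.castSucc :
        Measurable fun p : Fin (T + 1) → Param d => p i.castSucc)).aemeasurable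

end Path

/-! ### The convergence rate -/

section Rate

variable {d H : ℕ} [NeZero d] {S A : Type*} [MeasurableSpace S] [MeasurableSpace A]
  (𝓜 : EpisodicMDP S A H) (π : PolicyNetwork d S A)
  {σ : ℝ → unitInterval} {σinv : ℝ → ℝ} {L : ℝ≥0}

/-- Convergence to a stationary point for arbitrary parameters: the ascent inequality is summed over
the iterations, and the value stays in `[0, H]`. -/
lemma integral_zpgOutput_norm_gradient_sq_le (hσ : IsLink σ H)
    (hinv : IsLipschitzInverseLink σ σinv H L) (hV : LSmooth L (value 𝓜 π)) (hL : 0 < L)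
    {N M T : ℕ} (hN : N ≠ 0) (hM : M ≠ 0) (hT : T ≠ 0) {α μ : ℝ} (hα : 0 < α) (hμ : 0 < μ)
    (hstep : L * (α * d) ≤ 1 / 12) (θ₀ : Param d) :
    ∫ θ, ‖gradient (value 𝓜 π) θ‖ ^ 2 ∂(zpgOutput 𝓜 π hσ.measurable σinv N M α μ θ₀ T) ≤
      2 * (H / (α * T) + d * (L ^ 2 * (μ ^ 2 + 1 / (M * μ ^ 2) + 1 / (N * μ ^ 2)))) := by
  set E : ℝ := d * (L ^ 2 * (μ ^ 2 + 1 / (M * μ ^ 2) + 1 / (N * μ ^ 2))) with hE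
  set G : Param d → ℝ := fun θ => ‖gradient (value 𝓜 π) θ‖ ^ 2 with hG
  set ν := iterateLaw 𝓜 π hσ.measurable σinv N M α μ θ₀ with hν
  have hT' : (0 : ℝ) < T := by exact_mod_cast Nat.pos_of_ne_zero hT
  have hVm : Measurable (value 𝓜 π) := hV.1.continuous.measurable
  have hVmem := value_mem_Icc 𝓜 π
  have hVabs : ∀ θ, |value 𝓜 π θ| ≤ H := fun θ => by
    rw [abs_of_nonneg (hVmem θ).1]; exact (hVmem θ).2
  have hGm : Measurable G := (hV.2.continuous.norm.pow 2).measurable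
  have hGabs : ∀ θ, |G θ| ≤ 2 * L * H := fun θ => by
    rw [abs_of_nonneg (sq_nonneg _)]
    exact hV.norm_gradient_sq_le hL (fun θ => (hVmem θ).1) (fun θ => (hVmem θ).2) θ
  have hGint : ∀ t, Integrable G (ν t) := fun t =>
    .of_bound hGm.aestronglyMeasurable _ (ae_of_all _ hGabs)
  have hVint : ∀ t, Integrable (value 𝓜 π) (ν t) := fun t =>
    .of_bound hVm.aestronglyMeasurable _ (ae_of_all _ hVabs)
  have hu : ∀ t, ∫ θ, value 𝓜 π θ ∂(ν t) ∈ Set.Icc (0 : ℝ) H := fun t =>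
    ⟨integral_nonneg fun θ => (hVmem θ).1,
      (integral_mono (hVint t) (integrable_const (H : ℝ)) fun θ => (hVmem θ).2).trans (by simp)⟩
  have hone : ∀ t, α * ((∫ θ, G θ ∂(ν t)) / 2 - E) ≤
      ∫ θ, value 𝓜 π θ ∂(ν (t + 1)) - ∫ θ, value 𝓜 π θ ∂(ν t) := by
    intro t
    have hP : Integrable (fun θ => ∫ θ', value 𝓜 π θ'
        ∂(zpgStep 𝓜 π hσ.measurable σinv N M α μ θ)) (ν t) := by
      refine .of_bound hVm.stronglyMeasurable.integral_kernel.aestronglyMeasurable H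
        (ae_of_all _ fun θ => ?_)
      exact (norm_integral_le_of_norm_le_const (ae_of_all _ hVabs)).trans (by simp)
    rw [hν, integral_iterateLaw_succ 𝓜 π hσ.measurable σinv N M α μ θ₀ t hVm hVabs, ← hν,
      ← integral_sub hP (hVint t)]
    calc _ = ∫ θ, α * (G θ / 2 - E) ∂(ν t) := by
          rw [integral_const_mul, integral_sub ((hGint t).div_const 2) (integrable_const E),
            integral_div]
          simp
      _ ≤ _ := integral_mono ((((hGint t).div_const 2).sub (integrable_const E)).const_mul α)
          (hP.sub (hVint t))
          fun θ => le_integral_zpgStep_sub 𝓜 π hσ hinv hV hN hM hα.le hμ hstep θ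
  have hsum : α * ((∑ t ∈ Finset.range T, ∫ θ, G θ ∂(ν t)) / 2 - T * E) ≤ H := by
    have h := Finset.sum_le_sum fun t (_ : t ∈ Finset.range T) => hone t
    rw [Finset.sum_range_sub (fun t => ∫ θ, value 𝓜 π θ ∂(ν t)), ← Finset.mul_sum,
      Finset.sum_sub_distrib, ← Finset.sum_div] at h
    simp only [Finset.sum_const, Finset.card_range, nsmul_eq_mul] at h
    linarith [(hu T).2, (hu 0).1]
  rw [integral_zpgOutput 𝓜 π hσ.measurable σinv N M α μ θ₀ hT hGm hGabs, ← hν, div_le_iff₀ hT']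
  have h1 : (∑ t ∈ Finset.range T, ∫ θ, G θ ∂(ν t)) / 2 - T * E ≤ H / α := by
    rw [le_div_iff₀ hα]; linarith
  have h2 : 2 * (H / (α * T) + E) * T = 2 * (H / α + T * E) := by
    field_simp
  rw [h2]
  linarith

end Rate

/-- The error terms for the prescribed step size `α` and perturbation distance `μ`. The terms with
`μ²` are balanced by `μ² ≈ max (1 / √M) (H / √(d N))`; `d ≥ 1` and `H ≥ 1` absorb the remaining
factors, and `√(log M) ≥ 1 / 2` for `M ≥ 2`. -/
lemma error_le_rate {L a₁ m₁ m₂ α μ d H T N M : ℝ} (ha : 0 < a₁) (hm₁ : 0 < m₁) (hm₂ : 0 < m₂)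
    (hd : 1 ≤ d) (hH : 1 ≤ H) (hT : 0 < T) (hN : 0 < N) (hM : 2 ≤ M)
    (hα : a₁ / d ≤ α)
    (hμ₁ : m₁ * max (1 / √M) (H / √(d * N)) ≤ μ ^ 2)
    (hμ₂ : μ ^ 2 ≤ m₂ * max (1 / √M) (H / √(d * N))) :
    2 * (H / (α * T) + d * (L ^ 2 * (μ ^ 2 + 1 / (M * μ ^ 2) + 1 / (N * μ ^ 2)))) ≤
      6 * (1 / a₁ + L ^ 2 * (m₂ + 1 / m₁)) *
        (H * d / T + d ^ 2 * √(Real.log M) / √M + H * d * √d / √N) := by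
  have hd0 : 0 < d := by linarith
  have hH0 : 0 < H := by linarith
  have hM0 : 0 < M := by linarith
  have hsM : 0 < √M := Real.sqrt_pos.2 hM0
  have hsN : 0 < √N := Real.sqrt_pos.2 hN
  have hsd : 1 ≤ √d := Real.one_le_sqrt.2 hd
  have hsd0 : 0 < √d := by linarith
  have hMM : √M * √M = M := Real.mul_self_sqrt hM0.le
  have hNN : √N * √N = N := Real.mul_self_sqrt hN.le
  have hdd : √d * √d = d := Real.mul_self_sqrt hd0.le
  have hlog : 1 / 2 ≤ √(Real.log M) := by
    refine Real.le_sqrt_of_sq_le ?_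
    have := Real.log_le_log (by norm_num) hM
    linarith [Real.log_two_gt_d9]
  rw [Real.sqrt_mul hd0.le] at hμ₁ hμ₂
  set x := H * d / T with hx
  set y := d ^ 2 * √(Real.log M) / √M with hy
  set z := H * d * √d / √N with hz
  have hx0 : 0 ≤ x := by positivity
  have hy0 : 0 ≤ y := by positivity
  have hz0 : 0 ≤ z := by positivity
  -- `d μ²` has the order of one of the next two left-hand sides
  have hdM : d / √M ≤ 2 * y := by
    rw [hy, mul_div_assoc', div_le_div_iff_of_pos_right hsM]
    nlinarith [mul_le_mul hd hlog (by norm_num) hd0.le]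
  have hdN : H * √d / √N ≤ z := by
    rw [hz, div_le_div_iff_of_pos_right hsN]
    nlinarith [mul_pos hH0 hsd0]
  have hT1 : H / (α * T) ≤ 1 / a₁ * x := by
    have hα' : a₁ ≤ α * d := (div_le_iff₀ hd0).1 hα
    have hα0 : 0 < α := lt_of_lt_of_le (by positivity) hα
    rw [hx, div_le_iff₀ (by positivity)]
    have : 1 / a₁ * (H * d / T) * (α * T) = H * (α * d / a₁) := by field_simp
    rw [this]
    exact le_mul_of_one_le_right hH0.le ((one_le_div ha).2 hα')
  have hT2 : d * μ ^ 2 ≤ m₂ * (2 * y + z) := by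
    have h1 : max (1 / √M) (H / (√d * √N)) ≤ 1 / √M + H / (√d * √N) :=
      max_le_add_of_nonneg (by positivity) (by positivity)
    calc d * μ ^ 2 ≤ d * (m₂ * (1 / √M + H / (√d * √N))) := by
          gcongr
          exact hμ₂.trans (by gcongr)
      _ = m₂ * (d / √M + H * (√d * √d) / (√d * √N)) := by rw [hdd]; ring
      _ = m₂ * (d / √M + H * √d / √N) := by
          congr 2
          field_simp
      _ ≤ m₂ * (2 * y + z) := by gcongr
  have hT3 : d * (1 / (M * μ ^ 2)) ≤ 1 / m₁ * (2 * y) := by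
    have h1 : m₁ * (1 / √M) ≤ μ ^ 2 := le_trans (by gcongr; exact le_max_left _ _) hμ₁
    calc d * (1 / (M * μ ^ 2)) ≤ d * (1 / (M * (m₁ * (1 / √M)))) := by gcongr
      _ = 1 / m₁ * (d / √M) := by
          nth_rewrite 1 [← hMM]
          field_simp
      _ ≤ _ := by gcongr
  have hT4 : d * (1 / (N * μ ^ 2)) ≤ 1 / m₁ * z := by
    have h1 : m₁ * (H / (√d * √N)) ≤ μ ^ 2 := le_trans (by gcongr; exact le_max_right _ _) hμ₁
    calc d * (1 / (N * μ ^ 2)) ≤ d * (1 / (N * (m₁ * (H / (√d * √N))))) := by gcongr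
      _ = 1 / m₁ * (d * √d / √N / H) := by
          nth_rewrite 1 [← hNN]
          field_simp
      _ ≤ 1 / m₁ * z := by
          gcongr
          rw [hz, div_le_iff₀ hH0, div_mul_eq_mul_div, div_le_div_iff_of_pos_right hsN]
          have : 0 < d * √d := by positivity
          nlinarith [mul_le_mul hH hH zero_le_one hH0.le]
  have hL2 : 0 ≤ L ^ 2 := sq_nonneg L
  have hi : 0 < 1 / a₁ := by positivity
  have hj : 0 < 1 / m₁ := by positivity
  calc 2 * (H / (α * T) + d * (L ^ 2 * (μ ^ 2 + 1 / (M * μ ^ 2) + 1 / (N * μ ^ 2))))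
      = 2 * (H / (α * T) + L ^ 2 * (d * μ ^ 2 + d * (1 / (M * μ ^ 2)) + d * (1 / (N * μ ^ 2)))) := by
        ring
    _ ≤ 2 * (1 / a₁ * x + L ^ 2 * (m₂ * (2 * y + z) + 1 / m₁ * (2 * y) + 1 / m₁ * z)) := by gcongr
    _ = 2 * (1 / a₁) * x + L ^ 2 * (m₂ + 1 / m₁) * (4 * y + 2 * z) := by ring
    _ ≤ 6 * (1 / a₁) * (x + y + z) + L ^ 2 * (m₂ + 1 / m₁) * (6 * (x + y + z)) := by
        gcongr
        · norm_num
        · linarith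
        · linarith
    _ = _ := by ring

end ZPG

theorem theorem1 :
    ∃ K : ℝ, 0 < K ∧
      ∀ (L : ℝ≥0) (a₁ m₁ m₂ : ℝ), 0 < a₁ → 0 < m₁ → 0 < m₂ →
      ∀ (d H T N M : ℕ), 1 ≤ d → 1 ≤ H → 1 ≤ T → 1 ≤ N → 2 ≤ M →
      ∀ (S A : Type*) [MeasurableSpace S] [MeasurableSpace A]
        (𝓜 : ZPG.EpisodicMDP S A H) (π : ZPG.PolicyNetwork d S A)
        (σ : ℝ → unitInterval) (σinv : ℝ → ℝ) (hσ : ZPG.IsLink σ H),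
        ZPG.IsLipschitzInverseLink σ σinv H L →
        ZPG.LSmooth L (ZPG.value 𝓜 π) →
      ∀ (α μ : ℝ) (θ₀ : ZPG.Param d),
        a₁ / d ≤ α → α ≤ 1 / (12 * L * d) →
        0 < μ →
        m₁ * max (1 / √(M : ℝ)) (H / √((d : ℝ) * N)) ≤ μ ^ 2 →
        μ ^ 2 ≤ m₂ * max (1 / √(M : ℝ)) (H / √((d : ℝ) * N)) →
        Integrable (fun θ => ‖gradient (ZPG.value 𝓜 π) θ‖ ^ 2)
            (ZPG.zpgOutput 𝓜 π hσ.measurable σinv N M α μ θ₀ T) ∧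
          ∫ θ, ‖gradient (ZPG.value 𝓜 π) θ‖ ^ 2
              ∂(ZPG.zpgOutput 𝓜 π hσ.measurable σinv N M α μ θ₀ T) ≤
            K * (1 / a₁ + (L : ℝ) ^ 2 * (m₂ + 1 / m₁)) *
              (H * d / T + (d : ℝ) ^ 2 * √(Real.log M) / √(M : ℝ)
                + H * d * √(d : ℝ) / √(N : ℝ)) := by
  refine ⟨6, by norm_num, ?_⟩
  intro L a₁ m₁ m₂ ha hm₁ hm₂ d H T N M hd hH hT hN hM S A _ _ 𝓜 π σ σinv hσ hinv hV α μ θ₀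
    hα₁ hα₂ hμ hμ₁ hμ₂
  have : NeZero d := ⟨by omega⟩
  have : NeZero T := ⟨by omega⟩
  have hd' : (1 : ℝ) ≤ d := by exact_mod_cast hd
  have hH' : (1 : ℝ) ≤ H := by exact_mod_cast hH
  have hL : (0 : ℝ) < L := by linarith [hinv.two_mul_le hσ]
  have hα : 0 < α := lt_of_lt_of_le (by positivity) hα₁
  have hstep : (L : ℝ) * (α * d) ≤ 1 / 12 := by
    rw [le_div_iff₀ (by positivity)] at hα₂
    linarith
  refine ⟨?_, ?_⟩
  · refine .of_bound (hV.2.continuous.norm.pow 2).aestronglyMeasurable (2 * L * H)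
      (ae_of_all _ fun θ => ?_)
    rw [Real.norm_of_nonneg (sq_nonneg _)]
    exact hV.norm_gradient_sq_le hL (fun θ => (ZPG.value_mem_Icc 𝓜 π θ).1)
      (fun θ => (ZPG.value_mem_Icc 𝓜 π θ).2) θ
  · exact (ZPG.integral_zpgOutput_norm_gradient_sq_le 𝓜 π hσ hinv hV hL (by omega) (by omega)
      (by omega) hα hμ hstep θ₀).trans (ZPG.error_le_rate ha hm₁ hm₂ hd' hH'
        (by exact_mod_cast hT) (by exact_mod_cast hN) (by exact_mod_cast hM) hα₁ hμ₁ hμ₂)
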